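/- Fix constants $1>\theta_1\ge\theta_2\ge 0$. For each real $\lambda>0$ let $N_0$, $N_1$, $N_2$ be mutually independent Poisson counting processes on $[0,1]$ (paths nondecreasing, right-continuous and starting at $0$) with rates $\lambda$, $\theta_1\lambda$, $\theta_2\lambda$ respectively, where a process of rate $0$ is identically zero almost surely. The mirror image of a counting process $N$ on $[0,1]$ is $\tilde N(r)=N(1)-N(1-r)$, $r\in[0,1]$. Let $\tilde N_0$, $\tilde N_1$ be the mirror images of $N_0$, $N_1$, and put $$X=\max_{r\in[0,1]}\bigl\{\tilde N_0(1-r)+N_1(r)\bigr\},\qquad Y=\max_{r\in[0,1]}\bigl\{\tilde N_1(1-r)+N_2(r)\bigr\}.$$ Then, with $C=\lambda$, $$\lim_{\lambda\to\infty}\mathbb P(X\ge C)=\tfrac12,\qquad \lim_{\lambda\to\infty}\mathbb P(Y\ge C)=0.$$ -/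

import Mathlib

open MeasureTheory ProbabilityTheory Filter Topology
open scoped NNReal

namespace AdvancedReservation

/-- `N` is a (homogeneous) Poisson counting process of rate `rate` on the time interval `[0,1]`,
under the probability measure `P`: a stochastic process with values in `ℕ` whose paths start at `0`,
are nondecreasing and right-continuous, which has independent increments, and whose increment over
`(s,t]` is Poisson distributed with mean `rate * (t - s)`. The rate `0` is allowed
(no occurrences). Subtraction in `ℕ` is exact here because the paths are nondecreasing. -/
structure IsPoissonProcess {Ω : Type*} [MeasurableSpace Ω]
    (N : unitInterval → Ω → ℕ) (rate : ℝ≥0) (P : Measure Ω) : Prop where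
  measurable : ∀ t, Measurable (N t)
  start_zero : ∀ ω, N 0 ω = 0
  monotone_path : ∀ ω, Monotone (fun t => N t ω)
  rightContinuous_path : ∀ ω t, ContinuousWithinAt (fun s => N s ω) (Set.Ici t) t
  indep_increments : HasIndepIncrements N P
  increment_law : ∀ s t : unitInterval, s ≤ t →
    HasLaw (fun ω => N t ω - N s ω)
      (poissonMeasure (rate * Real.toNNReal ((t : ℝ) - (s : ℝ)))) P

/-- The mirror image `r ↦ N(1) - N(1 - r)` of a counting process on `[0,1]`
(`unitInterval.symm r` is `1 - r`). -/
def mirror {Ω : Type*} (N : unitInterval → Ω → ℕ) (r : unitInterval) (ω : Ω) : ℕ :=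
  N 1 ω - N (unitInterval.symm r) ω

/-- The random variable `max_{r ∈ [0,1]} (Ñ(1 - r) + N'(r))`, with `Ñ` the mirror image of `N`. -/
noncomputable def maxLoad {Ω : Type*} (N N' : unitInterval → Ω → ℕ) (ω : Ω) : ℕ :=
  ⨆ r : unitInterval, (mirror N (unitInterval.symm r) ω + N' r ω)

/-- The supremum in `maxLoad` is an attained maximum as soon as the path of the
forward process is nondecreasing. -/
theorem isGreatest_maxLoad {Ω : Type*} (N N' : unitInterval → Ω → ℕ) (ω : Ω)
    (h : Monotone (fun t => N' t ω)) :
    IsGreatest (Set.range fun r : unitInterval =>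
      mirror N (unitInterval.symm r) ω + N' r ω) (maxLoad N N' ω) := by
  have hb : BddAbove (Set.range fun r : unitInterval =>
      mirror N (unitInterval.symm r) ω + N' r ω) := by
    refine ⟨N 1 ω + N' 1 ω, ?_⟩
    rintro _ ⟨r, rfl⟩
    exact add_le_add (Nat.sub_le _ _) (h unitInterval.le_one')
  exact ⟨Nat.sSup_mem (Set.range_nonempty _) hb, fun _ hx => le_csSup hb hx⟩

end AdvancedReservation

/-! Unmirrored, the load at `r` is `(N 1 - N r) + N' r`. For `X`, taking `r = 0` gives `X ≥ N₀ 1`, a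
Poisson variable of mean `λ`, which reaches its mean with probability tending to 1/2. Conversely, if
`X ≥ λ`, then either `N₀ 1 ≥ λ - c√λ`, or `N₁` leads `N₀` by `c√λ` at some time, up to one grid
step. As `θ₁ < 1`, the lead has negative drift, and a Chernoff bound summed over about `λ` grid
points kills the second case (`measureReal_le_maxLoad_le`). The central limit theorem handles the
first; then `c → 0`. For `Y`, every load is Poisson of mean at most `θ₁ λ`, so a fixed grid and
Chernoff give exponential decay (`measureReal_le_maxLoad_le_exp`). -/

namespace ProbabilityTheory

/-! ### Exponential moments and Chernoff bounds for Poisson variables. -/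

section Poisson

variable {Ω : Type*} [MeasurableSpace Ω] {P : Measure Ω}

theorem hasSum_exp_mul_poisson (r : ℝ≥0) (t : ℝ) :
    HasSum (fun n : ℕ => Real.exp (-r) * r ^ n / (n.factorial : ℝ) * Real.exp (t * n))
      (Real.exp (r * (Real.exp t - 1))) := by
  have h := (NormedSpace.expSeries_div_hasSum_exp ((r : ℝ) * Real.exp t)).mul_left
    (Real.exp (-(r : ℝ)))
  rw [← Real.exp_eq_exp_ℝ, ← Real.exp_add] at h
  rw [show (r : ℝ) * (Real.exp t - 1) = -r + r * Real.exp t by ring]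
  convert! h using 2 with n
  rw [mul_pow, ← Real.exp_nat_mul, mul_comm t]
  ring

theorem integrable_exp_mul_poissonMeasure (r : ℝ≥0) (t : ℝ) :
    Integrable (fun n : ℕ => Real.exp (t * n)) (poissonMeasure r) := by
  rw [integrable_poissonMeasure_iff]
  simpa using (hasSum_exp_mul_poisson r t).summable

theorem integral_exp_mul_poissonMeasure (r : ℝ≥0) (t : ℝ) :
    ∫ n : ℕ, Real.exp (t * n) ∂(poissonMeasure r) = Real.exp (r * (Real.exp t - 1)) := by
  rw [integral_poissonMeasure]
  exact (hasSum_exp_mul_poisson r t).tsum_eq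

theorem HasLaw.integrable_exp_mul_poisson {A : Ω → ℕ} {r : ℝ≥0}
    (hA : HasLaw A (poissonMeasure r) P) (t : ℝ) :
    Integrable (fun ω => Real.exp (t * A ω)) P := by
  have h := integrable_exp_mul_poissonMeasure r t
  rw [← hA.map_eq] at h
  exact h.comp_aemeasurable hA.aemeasurable

theorem HasLaw.mgf_poisson {A : Ω → ℕ} {r : ℝ≥0}
    (hA : HasLaw A (poissonMeasure r) P) (t : ℝ) :
    mgf (fun ω => (A ω : ℝ)) P t = Real.exp (r * (Real.exp t - 1)) := by
  rw [← integral_exp_mul_poissonMeasure,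
    ← hA.integral_comp (f := fun n : ℕ => Real.exp (t * n)) .of_discrete]
  rfl

/-- Chernoff bound for a Poisson variable. -/
theorem HasLaw.measureReal_ge_le_poisson [IsFiniteMeasure P] {A : Ω → ℕ} {r : ℝ≥0}
    (hA : HasLaw A (poissonMeasure r) P) {t : ℝ} (ht : 0 ≤ t) (x : ℝ) :
    P.real {ω | x ≤ A ω} ≤ Real.exp (-t * x + r * (Real.exp t - 1)) := by
  rw [Real.exp_add, ← hA.mgf_poisson]
  exact measure_ge_le_exp_mul_mgf x ht (hA.integrable_exp_mul_poisson t)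

/-- Chernoff bound for a difference of independent Poisson variables. -/
theorem IndepFun.measureReal_ge_sub_le_poisson [IsFiniteMeasure P] {A B : Ω → ℕ} {a b : ℝ≥0}
    (hAB : IndepFun A B P) (hA : HasLaw A (poissonMeasure a) P)
    (hB : HasLaw B (poissonMeasure b) P) {t : ℝ} (ht : 0 ≤ t) (x : ℝ) :
    P.real {ω | x ≤ (A ω : ℝ) - B ω} ≤
      Real.exp (-t * x + (a * (Real.exp t - 1) + b * (Real.exp (-t) - 1))) := by
  have hA' : AEMeasurable (fun ω => (A ω : ℝ)) P :=
    (measurable_from_nat (f := fun n : ℕ => (n : ℝ))).comp_aemeasurable hA.aemeasurable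
  have hB' : AEMeasurable (fun ω => -(B ω : ℝ)) P :=
    (measurable_from_nat (f := fun n : ℕ => -(n : ℝ))).comp_aemeasurable hB.aemeasurable
  have hind : IndepFun (fun ω => (A ω : ℝ)) (fun ω => -(B ω : ℝ)) P :=
    hAB.comp (φ := fun n : ℕ => (n : ℝ)) (ψ := fun n : ℕ => -(n : ℝ))
      measurable_from_nat measurable_from_nat
  have hIB : Integrable (fun ω => Real.exp (t * -(B ω : ℝ))) P := by
    simpa using hB.integrable_exp_mul_poisson (-t)
  have hint := hind.integrable_exp_mul_add (hA.integrable_exp_mul_poisson t) hIB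
  have hmgf := hind.mgf_add' hA'.aestronglyMeasurable hB'.aestronglyMeasurable (t := t)
  have hBm : mgf (fun ω => -(B ω : ℝ)) P t = Real.exp (b * (Real.exp (-t) - 1)) := by
    rw [← hB.mgf_poisson]
    exact mgf_neg
  rw [hA.mgf_poisson, hBm, ← Real.exp_add] at hmgf
  rw [Real.exp_add, ← hmgf]
  simpa [sub_eq_add_neg] using measure_ge_le_exp_mul_mgf x ht hint

/-! ### Central limit theorem for the Poisson law. -/

/-- The standardization of the Poisson distribution of mean `r`. -/
noncomputable def standardizedPoisson (r : ℝ≥0) : Measure ℝ :=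
  (((poissonMeasure r).map (Nat.cast : ℕ → ℝ)).map (fun x => (√r)⁻¹ * x)).map (fun x => x + -√r)

instance isProbabilityMeasure_standardizedPoisson (r : ℝ≥0) :
    IsProbabilityMeasure (standardizedPoisson r) := by
  have := Measure.isProbabilityMeasure_map (μ := poissonMeasure r)
    (f := (Nat.cast : ℕ → ℝ)) (measurable_from_nat).aemeasurable
  have := Measure.isProbabilityMeasure_map (μ := (poissonMeasure r).map (Nat.cast : ℕ → ℝ))
    (f := fun x => (√r)⁻¹ * x) (by fun_prop)
  exact Measure.isProbabilityMeasure_map (by fun_prop)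

theorem standardizedPoisson_real_Ici {r : ℝ≥0} (hr : 0 < r) (c : ℝ) :
    (standardizedPoisson r).real (Set.Ici (-c)) =
      (poissonMeasure r).real {n : ℕ | (r : ℝ) - c * √r ≤ n} := by
  have hs : 0 < √(r : ℝ) := Real.sqrt_pos.2 (by exact_mod_cast hr)
  have hm : Measurable (Nat.cast : ℕ → ℝ) := measurable_from_nat
  rw [standardizedPoisson, map_measureReal_apply (by fun_prop) measurableSet_Ici,
    map_measureReal_apply (by fun_prop) (measurableSet_Ici.preimage (by fun_prop)),
    map_measureReal_apply hm
      ((measurableSet_Ici.preimage (by fun_prop)).preimage (by fun_prop))]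
  congr 1
  ext n
  have h2 : √(r : ℝ) * √(r : ℝ) = r := Real.mul_self_sqrt r.2
  simp only [Set.mem_preimage, Set.mem_Ici, Set.mem_ofPred_eq]
  rw [← sub_eq_add_neg, le_sub_iff_add_le, inv_mul_eq_div, le_div_iff₀ hs]
  constructor <;> intro h <;> nlinarith

theorem charFun_standardizedPoisson (r : ℝ≥0) (t : ℝ) :
    charFun (standardizedPoisson r) t =
      Complex.exp (r * (Complex.exp (((√r)⁻¹ * t : ℝ) * Complex.I) - 1) - t * √r * Complex.I) := by
  rw [standardizedPoisson, charFun_map_add_const, charFun_map_mul,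
    charFun_map_cast_poissonMeasure, ← Complex.exp_add]
  congr 1
  simp
  ring

/-- With `z = it/√r` the exponent is `r (exp z - 1 - z)`. Its quadratic term is exactly `-t²/2`, and
the Taylor remainder is at most `r |z|³ exp |z|`, of order `1/√r`. -/
theorem tendsto_charFun_standardizedPoisson (t : ℝ) :
    Tendsto (fun r : ℝ≥0 => charFun (standardizedPoisson r) t) atTop
      (𝓝 (charFun (gaussianReal 0 1) t)) := by
  simp_rw [charFun_standardizedPoisson, charFun_gaussianReal]
  refine (Complex.continuous_exp.tendsto _).comp ?_
  have hcoe : Tendsto (fun r : ℝ≥0 => (r : ℝ)) atTop atTop := NNReal.tendsto_coe_atTop.2 tendsto_id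
  have hs : Tendsto (fun r : ℝ≥0 => √(r : ℝ)) atTop atTop := Real.tendsto_sqrt_atTop.comp hcoe
  have hu : Tendsto (fun r : ℝ≥0 => (√(r : ℝ))⁻¹) atTop (𝓝 0) := tendsto_inv_atTop_zero.comp hs
  rw [tendsto_iff_norm_sub_tendsto_zero]
  have hbound : Tendsto (fun r : ℝ≥0 => |t| ^ 3 * (√(r : ℝ))⁻¹ * Real.exp ((√(r : ℝ))⁻¹ * |t|))
      atTop (𝓝 0) := by
    have := (hu.const_mul (|t| ^ 3)).mul ((Real.continuous_exp.tendsto _).comp (hu.mul_const |t|))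
    simpa using this
  refine squeeze_zero' (Eventually.of_forall fun _ => norm_nonneg _) ?_ hbound
  filter_upwards [eventually_gt_atTop 0] with r hr
  have hs0 : 0 < √(r : ℝ) := Real.sqrt_pos.2 (by exact_mod_cast hr)
  have hsq : √(r : ℝ) * √(r : ℝ) = r := Real.mul_self_sqrt r.2
  set s : ℝ := √(r : ℝ) with hsdef
  set z : ℂ := ((s⁻¹ * t : ℝ) : ℂ) * Complex.I with hz
  have hzn : ‖z‖ = s⁻¹ * |t| := by
    rw [hz, norm_mul, Complex.norm_real, Complex.norm_I, mul_one, Real.norm_eq_abs, abs_mul,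
      abs_of_pos (inv_pos.2 hs0)]
  have hsc : (s : ℂ) ≠ 0 := by exact_mod_cast hs0.ne'
  have hr2 : ((r : ℝ) : ℂ) = (s : ℂ) * s := by rw [← hsq]; push_cast; rfl
  have key := Complex.norm_exp_sub_sum_le_norm_mul_exp z 3
  have e : (r : ℂ) * (Complex.exp z - 1) - t * s * Complex.I -
      (t * (0 : ℝ) * Complex.I - ((1 : ℝ≥0) : ℝ) * t ^ 2 / 2) =
      ((r : ℝ) : ℂ) * (Complex.exp z - ∑ m ∈ Finset.range 3, z ^ m / (m.factorial : ℂ)) := by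
    have hzz : z ^ 2 = -(t ^ 2 / (s * s)) := by
      rw [hz, mul_pow, Complex.I_sq]; push_cast; field_simp
    have hrz : (s : ℂ) * s * z = t * s * Complex.I := by
      rw [hz]; push_cast; field_simp
    simp only [Finset.sum_range_succ, Finset.sum_range_zero, Nat.factorial, hzz]
    change ((r : ℝ) : ℂ) * _ - _ - _ = _
    rw [hr2, ← hrz]
    push_cast
    field_simp
    ring
  have e2 : |t| ^ 3 * s⁻¹ * Real.exp (s⁻¹ * |t|) = r * (‖z‖ ^ 3 * Real.exp ‖z‖) := by
    rw [hzn, ← hsq]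
    field_simp
  rw [e2]
  refine le_trans (le_of_eq ?_) (mul_le_mul_of_nonneg_left key r.2)
  rw [e, norm_mul, Complex.norm_real, Real.norm_of_nonneg r.coe_nonneg]

theorem gaussianReal_zero_one_singleton (x : ℝ) : gaussianReal 0 1 {x} = 0 := by
  have := nullSingletonClass_gaussianReal (μ := 0) (v := 1) one_ne_zero
  exact measure_singleton x

/-- Central limit theorem for the Poisson distribution, along a continuous parameter. -/
theorem tendsto_poissonMeasure_real_ge (c : ℝ) :
    Tendsto (fun r : ℝ≥0 => (poissonMeasure r).real {n : ℕ | (r : ℝ) - c * √r ≤ n}) atTop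
      (𝓝 ((gaussianReal 0 1).real (Set.Ici (-c)))) := by
  have hmain : Tendsto (fun r : ℝ≥0 => (standardizedPoisson r).real (Set.Ici (-c))) atTop
      (𝓝 ((gaussianReal 0 1).real (Set.Ici (-c)))) := by
    -- `atTop` on `ℝ≥0` is countably generated, so Lévy's continuity theorem along sequences
    -- suffices.
    refine tendsto_of_seq_tendsto fun u hu => ?_
    let μ : ℕ → ProbabilityMeasure ℝ := fun n => ⟨standardizedPoisson (u n), inferInstance⟩
    let μ₀ : ProbabilityMeasure ℝ := ⟨gaussianReal 0 1, inferInstance⟩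
    have hw : Tendsto μ atTop (𝓝 μ₀) :=
      ProbabilityMeasure.tendsto_iff_tendsto_charFun.2 fun t =>
        (tendsto_charFun_standardizedPoisson t).comp hu
    have h := ProbabilityMeasure.tendsto_measure_of_null_frontier_of_tendsto' hw
      (E := Set.Ici (-c)) (by
        rw [frontier_Ici]
        exact gaussianReal_zero_one_singleton (-c))
    exact (ENNReal.tendsto_toReal (measure_ne_top _ _)).comp h
  refine hmain.congr' ?_
  filter_upwards [eventually_gt_atTop 0] with r hr
  exact standardizedPoisson_real_Ici hr c

theorem gaussianReal_real_Ici_zero : (gaussianReal 0 1).real (Set.Ici 0) = 1 / 2 := by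
  have h1 : (gaussianReal 0 1).real (Set.Iic 0) = (gaussianReal 0 1).real (Set.Ici 0) := by
    have h := gaussianReal_map_neg (μ := 0) (v := 1)
    rw [neg_zero] at h
    conv_lhs => rw [← h]
    rw [map_measureReal_apply (by fun_prop) measurableSet_Iic]
    simp
  have h2 : (gaussianReal 0 1).real (Set.Ioi 0) = (gaussianReal 0 1).real (Set.Ici 0) := by
    have := nullSingletonClass_gaussianReal (μ := 0) (v := 1) one_ne_zero
    exact measureReal_congr Ioi_ae_eq_Ici
  have h3 := probReal_compl_eq_one_sub (μ := gaussianReal 0 1) (s := Set.Iic (0 : ℝ))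
    measurableSet_Iic
  rw [Set.compl_Iic] at h3
  linarith

/-- Continuity from above along half-lines decreasing to `Ici 0`, which has mass 1/2. -/
theorem exists_gaussianReal_real_Ici_neg_lt {y : ℝ} (hy : 1 / 2 < y) :
    ∃ c > 0, (gaussianReal 0 1).real (Set.Ici (-c)) < y := by
  have h : Tendsto (fun n : ℕ => gaussianReal 0 1 (Set.Ici (-(1 / ((n : ℝ) + 1))))) atTop
      (𝓝 (gaussianReal 0 1 (⋂ n : ℕ, Set.Ici (-(1 / ((n : ℝ) + 1)))))) := by
    refine tendsto_measure_iInter_atTop (fun n => measurableSet_Ici.nullMeasurableSet) ?_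
      ⟨0, measure_ne_top _ _⟩
    intro m n hmn
    exact Set.Ici_subset_Ici.2 (neg_le_neg (Nat.one_div_le_one_div hmn))
  have hI : (⋂ n : ℕ, Set.Ici (-(1 / ((n : ℝ) + 1)))) = Set.Ici 0 := by
    ext x
    simp only [Set.mem_iInter, Set.mem_Ici]
    refine ⟨fun hx => ?_, fun hx n => le_trans (by simp; positivity) hx⟩
    have := (tendsto_one_div_add_atTop_nhds_zero_nat (𝕜 := ℝ)).neg
    rw [neg_zero] at this
    exact le_of_tendsto' this hx
  rw [hI] at h
  have h' := (ENNReal.tendsto_toReal (measure_ne_top _ _)).comp h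
  change Tendsto _ _ (𝓝 ((gaussianReal 0 1).real (Set.Ici 0))) at h'
  rw [gaussianReal_real_Ici_zero] at h'
  obtain ⟨n, hn⟩ := (h'.eventually (gt_mem_nhds hy)).exists
  exact ⟨1 / ((n : ℝ) + 1), by positivity, hn⟩

end Poisson

end ProbabilityTheory

/-! ### Reduction of the maximum to a finite grid. -/

namespace AdvancedReservation

/-- The grid point `i / m`, truncated to the unit interval. -/
noncomputable def grid (m i : ℕ) : unitInterval :=
  Set.projIcc 0 1 zero_le_one ((i : ℝ) / m)

theorem coe_grid (m i : ℕ) : (grid m i : ℝ) = min 1 ((i : ℝ) / m) := by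
  rw [grid, Set.coe_projIcc, max_eq_right]
  exact le_min zero_le_one (by positivity)

theorem coe_grid_succ_le (m i : ℕ) : (grid m (i + 1) : ℝ) ≤ grid m i + 1 / m := by
  rw [coe_grid, coe_grid, ← min_add_add_right]
  refine min_le_min ?_ ?_
  · have : (0 : ℝ) ≤ 1 / m := by positivity
    linarith
  · push_cast
    rw [add_div]

theorem exists_mem_grid {m : ℕ} (hm : 0 < m) (r : unitInterval) :
    ∃ i ∈ Finset.range (m + 1), grid m i ≤ r ∧ r ≤ grid m (i + 1) := by
  have hm' : (0 : ℝ) < m := by exact_mod_cast hm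
  have h0 : 0 ≤ (r : ℝ) * m := mul_nonneg r.2.1 hm'.le
  refine ⟨⌊(r : ℝ) * m⌋₊, ?_, ?_, ?_⟩
  · rw [Finset.mem_range, Nat.lt_succ_iff]
    refine Nat.floor_le_of_le ?_
    nlinarith [r.2.2]
  · rw [← Subtype.coe_le_coe, coe_grid]
    refine (min_le_right _ _).trans ?_
    rw [div_le_iff₀ hm']
    exact Nat.floor_le h0
  · rw [← Subtype.coe_le_coe, coe_grid]
    refine le_min r.2.2 ?_
    rw [le_div_iff₀ hm']
    push_cast
    exact (Nat.lt_floor_add_one _).le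

section Paths

variable {Ω : Type*} {N N' : unitInterval → Ω → ℕ} {ω : Ω}

theorem exists_maxLoad_eq (h' : Monotone fun t => N' t ω) :
    ∃ r, maxLoad N N' ω = (N 1 ω - N r ω) + N' r ω := by
  obtain ⟨r, hr⟩ := (isGreatest_maxLoad N N' ω h').1
  exact ⟨r, by rw [← hr]; simp [mirror]⟩

/-- By monotonicity, rounding `r` down in the first term and up in the second only increases the
load. The index `i = m` serves `r = 1`; truncation keeps `grid m (m + 1)` equal to 1. -/
theorem exists_maxLoad_le_grid (h : Monotone fun t => N t ω) (h' : Monotone fun t => N' t ω)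
    {m : ℕ} (hm : 0 < m) :
    ∃ i ∈ Finset.range (m + 1),
      maxLoad N N' ω ≤ (N 1 ω - N (grid m i) ω) + N' (grid m (i + 1)) ω := by
  obtain ⟨r, hr⟩ := exists_maxLoad_eq (N := N) h'
  obtain ⟨i, hi, h1, h2⟩ := exists_mem_grid hm r
  exact ⟨i, hi, hr.trans_le (add_le_add (Nat.sub_le_sub_left (h h1) _) (h' h2))⟩

theorem le_maxLoad (h' : Monotone fun t => N' t ω) (h0 : N 0 ω = 0) :
    N 1 ω ≤ maxLoad N N' ω := by
  have := (isGreatest_maxLoad N N' ω h').2 ⟨0, rfl⟩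
  simp only [mirror, unitInterval.symm_symm, h0] at this
  omega

end Paths

section Law

variable {Ω : Type*} [MeasurableSpace Ω] {P : Measure Ω} {N : unitInterval → Ω → ℕ} {a : ℝ≥0}

theorem IsPoissonProcess.hasLaw (hN : IsPoissonProcess N a P) (t : unitInterval) :
    HasLaw (N t) (poissonMeasure (a * Real.toNNReal t)) P := by
  have h := hN.increment_law 0 t unitInterval.nonneg'
  simpa [hN.start_zero] using h

theorem IsPoissonProcess.hasLaw_one (hN : IsPoissonProcess N a P) :
    HasLaw (N 1) (poissonMeasure a) P := by
  simpa using hN.hasLaw 1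

end Law

/-- The number of grid points is quadratic in `√lam`, so the exponential in `√lam` wins. -/
theorem tendsto_exp_neg_mul_sqrt {s : ℝ} (hs : 0 < s) (C : ℝ) :
    Tendsto (fun lam : ℝ≥0 => ((⌈lam⌉₊ : ℝ) + 1) * Real.exp (-s * √lam + C)) atTop (𝓝 0) := by
  have hcoe : Tendsto (fun r : ℝ≥0 => (r : ℝ)) atTop atTop := NNReal.tendsto_coe_atTop.2 tendsto_id
  have hsq : Tendsto (fun r : ℝ≥0 => √(r : ℝ)) atTop atTop := Real.tendsto_sqrt_atTop.comp hcoe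
  have h0 : Tendsto (fun y : ℝ => Real.exp C * (y ^ 2 * Real.exp (-s * y) + 2 * Real.exp (-s * y)))
      atTop (𝓝 0) := by
    have h1 : Tendsto (fun y : ℝ => y ^ 2 * Real.exp (-s * y)) atTop (𝓝 0) := by
      simpa using tendsto_rpow_mul_exp_neg_mul_atTop_nhds_zero 2 s hs
    have h2 : Tendsto (fun y : ℝ => Real.exp (-s * y)) atTop (𝓝 0) := by
      simpa using tendsto_rpow_mul_exp_neg_mul_atTop_nhds_zero 0 s hs
    simpa using (h1.add (h2.const_mul 2)).const_mul (Real.exp C)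
  refine squeeze_zero (fun lam => by positivity) (fun lam => ?_) (h0.comp hsq)
  have hc : (⌈lam⌉₊ : ℝ) ≤ lam + 1 := by exact_mod_cast (Nat.ceil_lt_add_one (zero_le (a := lam))).le
  have h3 : √(lam : ℝ) ^ 2 = lam := Real.sq_sqrt lam.2
  simp only [Function.comp_apply]
  rw [h3, Real.exp_add]
  have hp : 0 < Real.exp (-s * √(lam : ℝ)) * Real.exp C := by positivity
  nlinarith

/-! ### Union bounds for the maximal load. -/

section Bounds

variable {Ω : Type*} [MeasurableSpace Ω] {P : Measure Ω} [IsFiniteMeasure P]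
  {N N' : unitInterval → Ω → ℕ}

/-- If the second process is slower by a factor `θ < 1`, the maximal load exceeds a level `lam`
essentially only if the first process comes within `x` of that level. -/
theorem measureReal_le_maxLoad_le {lam θ : ℝ≥0} {t : ℝ} (ht : 0 ≤ t) (hθ : θ * Real.exp t ≤ 1)
    (hN : IsPoissonProcess N lam P) (hN' : IsPoissonProcess N' (θ * lam) P)
    (hind : IndepFun (fun ω r => N r ω) (fun ω r => N' r ω) P) (hlam : 0 < lam) (x : ℝ) :
    P.real {ω | (lam : ℝ) ≤ maxLoad N N' ω} ≤
      (poissonMeasure lam).real {n : ℕ | (lam : ℝ) - x ≤ n} +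
        ((⌈lam⌉₊ : ℝ) + 1) * Real.exp (-t * x + Real.exp t) := by
  -- With mesh at most `1 / lam`, rounding adds at most one expected arrival, which costs the factor
  -- `exp (exp t)`.
  set m := ⌈lam⌉₊ with hm
  have hm0 : 0 < m := Nat.ceil_pos.2 hlam
  have hlm : (lam : ℝ) ≤ m := by exact_mod_cast Nat.le_ceil lam
  have hm0' : (0 : ℝ) < m := by exact_mod_cast hm0
  have hsub : {ω | (lam : ℝ) ≤ maxLoad N N' ω} ⊆ {ω | (lam : ℝ) - x ≤ N 1 ω} ∪
      ⋃ i ∈ Finset.range (m + 1),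
        {ω | x ≤ (N' (grid m (i + 1)) ω : ℝ) - N (grid m i) ω} := by
    intro ω hω
    obtain ⟨i, hi, hle⟩ := exists_maxLoad_le_grid (N := N) (N' := N')
      (hN.monotone_path ω) (hN'.monotone_path ω) hm0
    by_contra hcon
    simp only [Set.mem_union, Set.mem_iUnion, Set.mem_ofPred_eq, not_or, not_exists, not_le]
      at hcon hω
    have h1 := hcon.1
    have h2 := hcon.2 i hi
    have h3 : N (grid m i) ω ≤ N 1 ω := hN.monotone_path ω unitInterval.le_one'
    have h4 : (maxLoad N N' ω : ℝ) ≤ N 1 ω - N (grid m i) ω + N' (grid m (i + 1)) ω := by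
      rw [← Nat.cast_sub h3]
      exact_mod_cast hle
    linarith
  refine (measureReal_mono hsub).trans ((measureReal_union_le _ _).trans (add_le_add ?_ ?_))
  · exact (hN.hasLaw_one.measureReal_eq (p := fun n : ℕ => (lam : ℝ) - x ≤ n) .of_discrete).le
  · refine (measureReal_biUnion_finset_le _ _).trans ?_
    have hcard : ((⌈lam⌉₊ : ℝ) + 1) * Real.exp (-t * x + Real.exp t) =
        ∑ _i ∈ Finset.range (m + 1), Real.exp (-t * x + Real.exp t) := by simp [hm]
    rw [hcard]
    refine Finset.sum_le_sum fun i _ => ?_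
    have hi : IndepFun (N' (grid m (i + 1))) (N (grid m i)) P :=
      (hind.comp (measurable_pi_apply (grid m i)) (measurable_pi_apply (grid m (i + 1)))).symm
    refine (hi.measureReal_ge_sub_le_poisson (hN'.hasLaw _) (hN.hasLaw _) ht x).trans ?_
    rw [Real.exp_le_exp]
    push_cast
    rw [Real.coe_toNNReal _ (grid m (i + 1)).2.1, Real.coe_toNNReal _ (grid m i).2.1]
    have hstep := coe_grid_succ_le m i
    have hg0 : 0 ≤ (grid m i : ℝ) := (grid m i).2.1
    generalize (grid m (i + 1) : ℝ) = g' at *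
    generalize (grid m i : ℝ) = g at *
    have he : 1 ≤ Real.exp t := Real.one_le_exp ht
    have hee : Real.exp t * Real.exp (-t) = 1 := by rw [← Real.exp_add]; simp
    have hem : 0 < Real.exp (-t) := Real.exp_pos _
    have hl0 : (0 : ℝ) < lam := hlam
    have hθ0 : (0 : ℝ) ≤ θ := θ.2
    have hθ1 : (θ : ℝ) ≤ Real.exp (-t) := by nlinarith
    -- The left side factors as `(exp t - 1) (θ - exp (-t))`.
    have hdrift : θ * (Real.exp t - 1) + (Real.exp (-t) - 1) ≤ 0 := by nlinarith
    have hθ2 : (θ : ℝ) ≤ 1 := by nlinarith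
    have hlm1 : lam * (1 / (m : ℝ)) ≤ 1 := by
      rw [mul_one_div, div_le_one hm0']; exact hlm
    have h1 : θ * lam * g' * (Real.exp t - 1) ≤
        θ * lam * (g + 1 / m) * (Real.exp t - 1) := by
      gcongr
    have h2 : θ * (lam * (1 / (m : ℝ))) * (Real.exp t - 1) ≤ 1 * 1 * (Real.exp t - 1) := by
      gcongr
    have h3 : lam * g * (θ * (Real.exp t - 1) + (Real.exp (-t) - 1)) ≤ 0 :=
      mul_nonpos_of_nonneg_of_nonpos (by positivity) hdrift
    nlinarith

/-- Exponential bound for the maximal load of two slow processes. -/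
theorem measureReal_le_maxLoad_le_exp {lam θ θ' : ℝ≥0} {t : ℝ} (ht : 0 ≤ t) (hθ : θ' ≤ θ)
    (hN : IsPoissonProcess N (θ * lam) P) (hN' : IsPoissonProcess N' (θ' * lam) P)
    (hind : IndepFun (fun ω r => N r ω) (fun ω r => N' r ω) P) {m : ℕ} (hm : 0 < m) :
    P.real {ω | (lam : ℝ) ≤ maxLoad N N' ω} ≤
      ((m : ℝ) + 1) * Real.exp (lam * (-t + θ * (1 + 1 / m) * (Real.exp t - 1))) := by
  have hsub : {ω | (lam : ℝ) ≤ maxLoad N N' ω} ⊆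
      ⋃ i ∈ Finset.range (m + 1), {ω | (lam : ℝ) ≤
        (((fun ω => N 1 ω - N (grid m i) ω) + N' (grid m (i + 1))) ω : ℕ)} := by
    intro ω hω
    obtain ⟨i, hi, hle⟩ := exists_maxLoad_le_grid (N := N) (N' := N')
      (hN.monotone_path ω) (hN'.monotone_path ω) hm
    simp only [Set.mem_iUnion, Set.mem_ofPred_eq] at hω ⊢
    exact ⟨i, hi, hω.trans (Nat.cast_le.2 hle)⟩
  refine (measureReal_mono hsub (measure_ne_top _ _)).trans ((measureReal_biUnion_finset_le _ _).trans ?_)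
  have hcard : ((m : ℝ) + 1) * Real.exp (lam * (-t + θ * (1 + 1 / m) * (Real.exp t - 1))) =
      ∑ _i ∈ Finset.range (m + 1),
        Real.exp (lam * (-t + θ * (1 + 1 / m) * (Real.exp t - 1))) := by simp
  rw [hcard]
  refine Finset.sum_le_sum fun i _ => ?_
  have hi : IndepFun (fun ω => N 1 ω - N (grid m i) ω) (N' (grid m (i + 1))) P :=
    hind.comp (φ := fun f : unitInterval → ℕ => f 1 - f (grid m i))
      (by fun_prop) (measurable_pi_apply (grid m (i + 1)))
  -- The two terms come from independent processes, so the load is itself Poisson.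
  have hlaw := hi.hasLaw_add_poissonMeasure
    (hN.increment_law (grid m i) 1 unitInterval.le_one') (hN'.hasLaw _)
  refine (hlaw.measureReal_ge_le_poisson ht _).trans ?_
  rw [Real.exp_le_exp]
  have hg1 : (grid m i : ℝ) ≤ 1 := (grid m i).2.2
  push_cast
  rw [Real.coe_toNNReal _ (grid m (i + 1)).2.1, Real.coe_toNNReal _ (by simpa using hg1)]
  have hstep := coe_grid_succ_le m i
  have hg0 : 0 ≤ (grid m (i + 1) : ℝ) := (grid m (i + 1)).2.1
  generalize (grid m (i + 1) : ℝ) = g' at *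
  generalize (grid m i : ℝ) = g at *
  have he : 1 ≤ Real.exp t := Real.one_le_exp ht
  have h1 : θ * lam * (1 - g) + θ' * lam * g' ≤ θ * lam * (1 + 1 / (m : ℝ)) := by
    have hb : (θ' : ℝ) * lam * g' ≤ θ * lam * (g + 1 / m) := by gcongr
    linarith
  have h2 := mul_le_mul_of_nonneg_right h1 (sub_nonneg.2 he)
  linarith

end Bounds

end AdvancedReservation

/-! ### The two limits. -/

open AdvancedReservation in
theorem tendsto_measureReal_le_maxLoad_half {θ : ℝ≥0} (hθ : θ < 1) {Ω : ℝ≥0 → Type*}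
    [∀ lam, MeasurableSpace (Ω lam)] {P : ∀ lam, Measure (Ω lam)}
    [∀ lam, IsProbabilityMeasure (P lam)] {N N' : ∀ lam, unitInterval → Ω lam → ℕ}
    (hN : ∀ lam, 0 < lam → IsPoissonProcess (N lam) lam (P lam))
    (hN' : ∀ lam, 0 < lam → IsPoissonProcess (N' lam) (θ * lam) (P lam))
    (hind : ∀ lam, 0 < lam → IndepFun (fun ω r => N lam r ω) (fun ω r => N' lam r ω) (P lam)) :
    Tendsto (fun lam : ℝ≥0 => (P lam).real {ω | (lam : ℝ) ≤ maxLoad (N lam) (N' lam) ω})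
      atTop (𝓝 (1 / 2)) := by
  have hθ' : (θ : ℝ) < 1 := hθ
  have hpos : (0 : ℝ) < 1 + θ := by have := θ.2; positivity
  -- Chosen so that `exp t > 1` and `θ exp t ≤ 1`; both follow from `θ < 1`.
  set t := Real.log (2 / (1 + θ)) with ht
  have hexp : Real.exp t = 2 / (1 + θ) := Real.exp_log (by positivity)
  have ht0 : 0 < t := Real.log_pos (by rw [lt_div_iff₀ hpos]; linarith)
  have hdrift : θ * Real.exp t ≤ 1 := by
    rw [hexp, ← mul_div_assoc, div_le_one hpos]; linarith
  refine tendsto_order.2 ⟨fun y hy => ?_, fun y hy => ?_⟩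
  · have h := tendsto_poissonMeasure_real_ge 0
    rw [neg_zero, gaussianReal_real_Ici_zero] at h
    filter_upwards [h.eventually (lt_mem_nhds hy), eventually_gt_atTop 0] with lam h1 hlam
    refine h1.trans_le ?_
    rw [← (hN lam hlam).hasLaw_one.measureReal_eq
      (p := fun n : ℕ => (lam : ℝ) - 0 * √lam ≤ n) .of_discrete]
    refine measureReal_mono fun ω hω => ?_
    simp only [Set.mem_ofPred_eq, zero_mul, sub_zero] at hω ⊢
    exact hω.trans (Nat.cast_le.2
      (le_maxLoad ((hN' lam hlam).monotone_path ω) ((hN lam hlam).start_zero ω)))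
  -- `c` is fixed before `lam → ∞`: the Gaussian mass stays below `y`, and the lead term vanishes.
  · obtain ⟨c, hc, hcy⟩ := exists_gaussianReal_real_Ici_neg_lt hy
    have h := (tendsto_poissonMeasure_real_ge c).add
      (tendsto_exp_neg_mul_sqrt (mul_pos ht0 hc) (Real.exp t))
    rw [add_zero] at h
    filter_upwards [h.eventually (gt_mem_nhds hcy), eventually_gt_atTop 0] with lam h1 hlam
    refine lt_of_le_of_lt ?_ h1
    have := measureReal_le_maxLoad_le ht0.le hdrift (hN lam hlam) (hN' lam hlam)
      (hind lam hlam) hlam (c * √lam)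
    rwa [← mul_assoc, neg_mul] at this

open AdvancedReservation in
theorem tendsto_measureReal_le_maxLoad_zero {θ θ' : ℝ≥0} (hθ : θ < 1) (hle : θ' ≤ θ)
    {Ω : ℝ≥0 → Type*} [∀ lam, MeasurableSpace (Ω lam)] {P : ∀ lam, Measure (Ω lam)}
    [∀ lam, IsProbabilityMeasure (P lam)] {N N' : ∀ lam, unitInterval → Ω lam → ℕ}
    (hN : ∀ lam, 0 < lam → IsPoissonProcess (N lam) (θ * lam) (P lam))
    (hN' : ∀ lam, 0 < lam → IsPoissonProcess (N' lam) (θ' * lam) (P lam))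
    (hind : ∀ lam, 0 < lam → IndepFun (fun ω r => N lam r ω) (fun ω r => N' lam r ω) (P lam)) :
    Tendsto (fun lam : ℝ≥0 => (P lam).real {ω | (lam : ℝ) ≤ maxLoad (N lam) (N' lam) ω})
      atTop (𝓝 0) := by
  have hθ' : (θ : ℝ) < 1 := hθ
  have hθ0 : (0 : ℝ) ≤ θ := θ.2
  -- `q` lies strictly between `θ` and 1; the grid need only be fine enough that every mean is at
  -- most `q lam`.
  set q : ℝ := (1 + θ) / 2 with hq
  have hq0 : 0 < q := by positivity
  have hq1 : q < 1 := by rw [hq]; linarith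
  obtain ⟨k, hk⟩ := exists_nat_one_div_lt (show 0 < (1 - (θ : ℝ)) / 2 by linarith)
  set m := k + 1 with hm
  have hmq : θ * (1 + 1 / (m : ℝ)) ≤ q := by
    have h1 : (1 : ℝ) / m < (1 - θ) / 2 := by rw [hm]; exact_mod_cast hk
    have h2 : (0 : ℝ) ≤ 1 / m := by positivity
    rw [hq]
    nlinarith
  -- The optimal Chernoff parameter for mean `q lam` and level `lam`; the rate becomes `log q + 1 -
  -- q < 0`.
  set t := -Real.log q with ht
  have ht0 : 0 < t := neg_pos.2 (Real.log_neg hq0 hq1)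
  have hexp : Real.exp t = q⁻¹ := by rw [ht, Real.exp_neg, Real.exp_log hq0]
  have hneg : -t + θ * (1 + 1 / (m : ℝ)) * (Real.exp t - 1) < 0 := by
    have h1 := Real.log_lt_sub_one_of_pos hq0 hq1.ne
    have h2 := mul_le_mul_of_nonneg_right hmq (sub_nonneg.2 (Real.one_le_exp ht0.le))
    have h3 : q * (Real.exp t - 1) = 1 - q := by rw [hexp]; field_simp
    rw [ht] at h2 h3 ⊢
    linarith
  have hcoe : Tendsto (fun r : ℝ≥0 => (r : ℝ)) atTop atTop := NNReal.tendsto_coe_atTop.2 tendsto_id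
  have hlim : Tendsto (fun lam : ℝ≥0 => ((m : ℝ) + 1) *
      Real.exp (lam * (-t + θ * (1 + 1 / m) * (Real.exp t - 1)))) atTop (𝓝 0) := by
    simpa using (Real.tendsto_exp_atBot.comp (hcoe.atTop_mul_const_of_neg hneg)).const_mul
      ((m : ℝ) + 1)
  refine squeeze_zero' (Eventually.of_forall fun _ => measureReal_nonneg) ?_ hlim
  filter_upwards [eventually_gt_atTop 0] with lam hlam
  exact measureReal_le_maxLoad_le_exp ht0.le hle (hN lam hlam) (hN' lam hlam)
    (hind lam hlam) (Nat.succ_pos k)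

theorem proposition1
    (θ₁ θ₂ : ℝ≥0) (hθ₁ : θ₁ < 1) (hθ₂ : θ₂ ≤ θ₁)
    (Ω : ℝ≥0 → Type*) [∀ lam, MeasurableSpace (Ω lam)]
    (P : ∀ lam, Measure (Ω lam)) [∀ lam, IsProbabilityMeasure (P lam)]
    (N₀ N₁ N₂ : ∀ lam, unitInterval → Ω lam → ℕ)
    (hN₀ : ∀ lam, 0 < lam → AdvancedReservation.IsPoissonProcess (N₀ lam) lam (P lam))
    (hN₁ : ∀ lam, 0 < lam → AdvancedReservation.IsPoissonProcess (N₁ lam) (θ₁ * lam) (P lam))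
    (hN₂ : ∀ lam, 0 < lam → AdvancedReservation.IsPoissonProcess (N₂ lam) (θ₂ * lam) (P lam))
    (hindep : ∀ lam, 0 < lam → iIndepFun (β := fun _ : Fin 3 => unitInterval → ℕ)
      ![fun ω r => N₀ lam r ω, fun ω r => N₁ lam r ω, fun ω r => N₂ lam r ω] (P lam)) :
    Tendsto (fun lam : ℝ≥0 =>
        (P lam).real {ω | (lam : ℝ) ≤ (AdvancedReservation.maxLoad (N₀ lam) (N₁ lam) ω : ℝ)})
      atTop (𝓝 (1 / 2)) ∧
    Tendsto (fun lam : ℝ≥0 =>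
        (P lam).real {ω | (lam : ℝ) ≤ (AdvancedReservation.maxLoad (N₁ lam) (N₂ lam) ω : ℝ)})
      atTop (𝓝 0) := by
  refine ⟨tendsto_measureReal_le_maxLoad_half hθ₁ hN₀ hN₁ fun lam hlam => ?_,
    tendsto_measureReal_le_maxLoad_zero hθ₁ hθ₂ hN₁ hN₂ fun lam hlam => ?_⟩
  · exact (hindep lam hlam).indepFun (i := 0) (j := 1) (by decide)
  · exact (hindep lam hlam).indepFun (i := 1) (j := 2) (by decide)
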